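/- Let $p\neq\ell$ be prime numbers and $\Lambda=\overline{\mathbb{Q}}_\ell$. Let $A_n=\Lambda\{\!\{x_1,\dots,x_n\}\!\}$ be the ring of locally convergent power series: those formal power series in $x_1,\dots,x_n$ whose coefficients lie in some finite extension of $\mathbb{Q}_\ell$ inside $\Lambda$ and which converge with some positive radius (both depending on the series). Let $m=(x_1,\dots,x_n)$ be its maximal ideal. Let $w>0$ be an integer and let $\alpha_1,\dots,\alpha_n\in\Lambda^*$ be Weil numbers of weight $w$, i.e. algebraic numbers that are units at all nonarchimedean places outside $p$ and have absolute value $p^{w/2}$ at all archimedean places. Let $\varphi$ be the $\Lambda$-algebra automorphism of $A_n$ given by the substitution $x_i\mapsto\alpha_i x_i$. Let $I\subseteq m$, $I\neq m$, be a prime ideal of $A_n$ with $\varphi(I)=I$. Then there exist $\lambda_1,\dots,\lambda_n\in\Lambda$, not all zero, such that $I$ is contained in the kernel of the (surjective) substitution homomorphism $\pi:A_n\to A_1=\Lambda\{\!\{x\}\!\}$, $x_i\mapsto\lambda_i x$, and such that after replacing $\varphi$ by a suitable power $\varphi^k$, $k\geq 1$ (hence each $\alpha_i$ by $\alpha_i^k$),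 the number $\alpha_i$ is the same for all indices $i$ with $\lambda_i\neq 0$. -/

import Mathlib

namespace LocConv

open MvPowerSeries Filter Topology

/-- An element `a` of a field `F` of characteristic zero is a Weil number of weight `w` (with
respect to the prime `p`): it lies in a number field `K`, it is a unit at all nonarchimedean
places of `K` which do not lie over `p`, and it has absolute value `p ^ (w / 2)` at all
archimedean places of `K`. -/
def IsWeilNumber (p w : ℕ) {F : Type*} [Field F] [CharZero F] (a : F) : Prop :=
  ∃ (K : IntermediateField ℚ F) (_ : NumberField K) (b : K), (b : F) = a ∧
    (∀ v : NumberField.FinitePlace K, v (p : K) = 1 → v b = 1) ∧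
    (∀ v : NumberField.InfinitePlace K, v b = (p : ℝ) ^ ((w : ℝ) / 2))

section Rings

variable (ℓ : ℕ) [Fact ℓ.Prime]

/-- A formal power series in `n` variables over the algebraic closure of `ℚ_[ℓ]` is locally
convergent if its coefficients lie in a finite extension `E` of `ℚ_[ℓ]` and if it converges on a
closed polydisc of some positive radius `r`. -/
def IsLocallyConvergent {n : ℕ} (f : MvPowerSeries (Fin n) (PadicAlgCl ℓ)) : Prop :=
  (∃ E : IntermediateField ℚ_[ℓ] (PadicAlgCl ℓ), FiniteDimensional ℚ_[ℓ] E ∧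
      ∀ d, coeff d f ∈ E) ∧
    ∃ r : ℝ, 0 < r ∧ IsRestricted (fun _ => r) f

variable {ℓ}

lemma prod_const {n : ℕ} (r : ℝ) (d : Fin n →₀ ℕ) :
    (d.prod fun _ k => r ^ k) = r ^ d.degree := by
  rw [Finsupp.prod, Finset.prod_pow_eq_pow_sum, Finsupp.degree_apply]

lemma finite_degree_le (n N : ℕ) : {d : Fin n →₀ ℕ | d.degree ≤ N}.Finite :=
  Finsupp.finite_of_degree_le N

/-- Convergence with a positive radius amounts to a geometric bound for the coefficients. -/
lemma exists_isRestricted_iff {n : ℕ} (f : MvPowerSeries (Fin n) (PadicAlgCl ℓ)) :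
    (∃ r : ℝ, 0 < r ∧ IsRestricted (fun _ => r) f) ↔
      ∃ r : ℝ, 0 < r ∧ ∃ B : ℝ, 0 ≤ B ∧ ∀ d, ‖coeff d f‖ * r ^ d.degree ≤ B := by
  constructor
  · rintro ⟨r, hr, h⟩
    refine ⟨r, hr, ?_⟩
    simp only [IsRestricted, prod_const] at h
    have h1 : {d : Fin n →₀ ℕ | ¬ ‖coeff d f‖ * r ^ d.degree < 1}.Finite :=
      h.eventually (gt_mem_nhds one_pos)
    obtain ⟨B, hB⟩ := (h1.image fun d => ‖coeff d f‖ * r ^ d.degree).bddAbove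
    refine ⟨max B 1, le_max_of_le_right zero_le_one, fun d => ?_⟩
    by_cases hd : ‖coeff d f‖ * r ^ d.degree < 1
    · exact hd.le.trans (le_max_right _ _)
    · exact (hB ⟨d, hd, rfl⟩).trans (le_max_left _ _)
  · rintro ⟨r, hr, B, hB, h⟩
    refine ⟨r / 2, by positivity, ?_⟩
    simp only [IsRestricted, prod_const]
    have h2 : Tendsto (fun d : Fin n →₀ ℕ => d.degree) cofinite atTop := by
      refine tendsto_atTop.2 fun N => ?_
      refine (finite_degree_le n N).subset fun d hd => ?_
      simp only [Set.mem_compl_iff, Set.mem_ofPred_eq, not_le] at hd ⊢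
      exact hd.le
    have h3 : Tendsto (fun d : Fin n →₀ ℕ => B * (1 / 2 : ℝ) ^ d.degree) cofinite (𝓝 0) := by
      have := (tendsto_pow_atTop_nhds_zero_of_lt_one (r := (1 / 2 : ℝ))
        (by norm_num) (by norm_num)).comp h2
      simpa using this.const_mul B
    refine squeeze_zero (fun d => by positivity) (fun d => ?_) h3
    have : (r / 2) ^ d.degree = r ^ d.degree * (1 / 2 : ℝ) ^ d.degree := by
      rw [← mul_pow]; congr 1; ring
    rw [this, ← mul_assoc]
    exact mul_le_mul_of_nonneg_right (h d) (by positivity)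

lemma IsRestricted.mono {n : ℕ} {f : MvPowerSeries (Fin n) (PadicAlgCl ℓ)} {r s : ℝ}
    (hs : 0 < s) (hsr : s ≤ r) (h : IsRestricted (fun _ => r) f) :
    IsRestricted (fun _ => s) f := by
  simp only [IsRestricted, prod_const] at h ⊢
  exact squeeze_zero (fun d => by positivity) (fun d => by gcongr) h

lemma IsLocallyConvergent.add {n : ℕ} {f g : MvPowerSeries (Fin n) (PadicAlgCl ℓ)}
    (hf : IsLocallyConvergent ℓ f) (hg : IsLocallyConvergent ℓ g) :
    IsLocallyConvergent ℓ (f + g) := by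
  obtain ⟨⟨E, hE, hfE⟩, r, hr, hfr⟩ := hf
  obtain ⟨⟨F, hF, hgF⟩, s, hs, hgs⟩ := hg
  refine ⟨⟨E ⊔ F, inferInstance, fun d => ?_⟩, min r s, lt_min hr hs, ?_⟩
  · rw [map_add]
    exact add_mem ((le_sup_left : E ≤ E ⊔ F) (hfE d)) ((le_sup_right : F ≤ E ⊔ F) (hgF d))
  · exact isRestricted.add _ (IsRestricted.mono (lt_min hr hs) (min_le_left _ _) hfr)
      (IsRestricted.mono (lt_min hr hs) (min_le_right _ _) hgs)

lemma IsLocallyConvergent.mul {n : ℕ} {f g : MvPowerSeries (Fin n) (PadicAlgCl ℓ)}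
    (hf : IsLocallyConvergent ℓ f) (hg : IsLocallyConvergent ℓ g) :
    IsLocallyConvergent ℓ (f * g) := by
  classical
  obtain ⟨⟨E, hE, hfE⟩, r, hr, hfr⟩ := hf
  obtain ⟨⟨F, hF, hgF⟩, s, hs, hgs⟩ := hg
  refine ⟨⟨E ⊔ F, inferInstance, fun d => ?_⟩, min r s, lt_min hr hs, ?_⟩
  · rw [coeff_mul]
    exact sum_mem fun x _ => mul_mem ((le_sup_left : E ≤ E ⊔ F) (hfE _))
      ((le_sup_right : F ≤ E ⊔ F) (hgF _))
  · exact isRestricted.mul _ (IsRestricted.mono (lt_min hr hs) (min_le_left _ _) hfr)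
      (IsRestricted.mono (lt_min hr hs) (min_le_right _ _) hgs)

lemma exists_finite_mem {ι : Type*} [Finite ι] (a : ι → PadicAlgCl ℓ) :
    ∃ E : IntermediateField ℚ_[ℓ] (PadicAlgCl ℓ), FiniteDimensional ℚ_[ℓ] E ∧ ∀ i, a i ∈ E := by
  refine ⟨IntermediateField.adjoin ℚ_[ℓ] (Set.range a),
    IntermediateField.finiteDimensional_adjoin fun x _ =>
      (Algebra.IsAlgebraic.isAlgebraic (R := ℚ_[ℓ]) x).isIntegral, fun i => ?_⟩
  exact IntermediateField.subset_adjoin _ _ ⟨i, rfl⟩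

lemma isLocallyConvergent_monomial {n : ℕ} (d : Fin n →₀ ℕ) (a : PadicAlgCl ℓ) :
    IsLocallyConvergent ℓ (monomial d a) := by
  classical
  obtain ⟨E, hE, ha⟩ := exists_finite_mem fun _ : Unit => a
  refine ⟨⟨E, hE, fun e => ?_⟩, 1, one_pos, isRestricted_monomial _ _ _⟩
  rw [coeff_monomial]
  split_ifs
  · exact ha ()
  · exact zero_mem E

variable (ℓ)

/-- The ring of locally convergent power series in `n` variables over the algebraic closure of
`ℚ_[ℓ]`. -/
def locConv (n : ℕ) : Subalgebra (PadicAlgCl ℓ) (MvPowerSeries (Fin n) (PadicAlgCl ℓ)) where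
  carrier := {f | IsLocallyConvergent ℓ f}
  mul_mem' := IsLocallyConvergent.mul
  add_mem' := IsLocallyConvergent.add
  algebraMap_mem' a := isLocallyConvergent_monomial 0 a

variable {ℓ}

/-- The coordinate `x_i`. -/
noncomputable def coord {n : ℕ} (i : Fin n) : locConv ℓ n :=
  ⟨X i, isLocallyConvergent_monomial _ _⟩

variable (ℓ) in
/-- The maximal ideal `(x_1, …, x_n)`. -/
noncomputable def maxIdeal (n : ℕ) : Ideal (locConv ℓ n) :=
  Ideal.span (Set.range coord)

lemma exists_norm_bound {n : ℕ} (a : Fin n → PadicAlgCl ℓ) :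
    ∃ L : ℝ, 0 < L ∧ ∀ d : Fin n →₀ ℕ, ‖d.prod fun i k => a i ^ k‖ ≤ L ^ d.degree := by
  refine ⟨1 + ∑ i, ‖a i‖, by positivity, fun d => ?_⟩
  rw [← prod_const, Finsupp.prod, Finsupp.prod, norm_prod]
  refine Finset.prod_le_prod (fun i _ => norm_nonneg _) fun i _ => ?_
  rw [norm_pow]
  gcongr
  have := Finset.single_le_sum (f := fun i => ‖a i‖) (fun i _ => norm_nonneg _)
    (Finset.mem_univ i)
  linarith

lemma prod_pow_mem {n : ℕ} {E : IntermediateField ℚ_[ℓ] (PadicAlgCl ℓ)}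
    {a : Fin n → PadicAlgCl ℓ} (ha : ∀ i, a i ∈ E) (d : Fin n →₀ ℕ) :
    (d.prod fun i k => a i ^ k) ∈ E :=
  prod_mem fun i _ => pow_mem (ha i) _

lemma IsLocallyConvergent.rescale {n : ℕ} (a : Fin n → PadicAlgCl ℓ)
    {f : MvPowerSeries (Fin n) (PadicAlgCl ℓ)} (hf : IsLocallyConvergent ℓ f) :
    IsLocallyConvergent ℓ (rescaleAlgHom a f) := by
  obtain ⟨⟨E, hE, hfE⟩, hr⟩ := hf
  obtain ⟨F, hF, haF⟩ := exists_finite_mem a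
  obtain ⟨r, hr, B, hB, h⟩ := (exists_isRestricted_iff f).1 hr
  obtain ⟨L, hL, haL⟩ := exists_norm_bound a
  refine ⟨⟨E ⊔ F, inferInstance, fun d => ?_⟩, (exists_isRestricted_iff _).2
    ⟨r / L, by positivity, B, hB, fun d => ?_⟩⟩
  · rw [rescaleAlgHom_apply, coeff_rescale]
    exact mul_mem ((le_sup_right : F ≤ E ⊔ F) (prod_pow_mem haF d))
      ((le_sup_left : E ≤ E ⊔ F) (hfE d))
  · rw [rescaleAlgHom_apply, coeff_rescale, norm_mul]
    calc _ ≤ L ^ d.degree * ‖coeff d f‖ * (r / L) ^ d.degree := by gcongr; exact haL d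
      _ = ‖coeff d f‖ * r ^ d.degree := by
        rw [div_pow]; field_simp
      _ ≤ B := h d

/-- The substitution `x_i ↦ a_i x_i`, as an endomorphism of the ring of locally convergent power
series. -/
noncomputable def scaleHom {n : ℕ} (a : Fin n → PadicAlgCl ℓ) :
    locConv ℓ n →ₐ[PadicAlgCl ℓ] locConv ℓ n :=
  ((rescaleAlgHom a).comp (locConv ℓ n).val).codRestrict (locConv ℓ n)
    fun f => IsLocallyConvergent.rescale a f.2

lemma scaleHom_comp {n : ℕ} (a b : Fin n → PadicAlgCl ℓ) (hab : a * b = 1) :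
    (scaleHom b).comp (scaleHom a) = AlgHom.id _ (locConv ℓ n) := by
  ext1 f
  apply Subtype.ext
  change rescaleAlgHom b (rescaleAlgHom a (f : MvPowerSeries (Fin n) (PadicAlgCl ℓ))) = f
  rw [← AlgHom.comp_apply, ← rescaleAlgHom_mul, hab, rescaleAlgHom_one]
  rfl

/-- The automorphism `φ` of the ring of locally convergent power series with `φ x_i = α_i x_i`. -/
noncomputable def phi {n : ℕ} (α : Fin n → (PadicAlgCl ℓ)ˣ) :
    locConv ℓ n ≃ₐ[PadicAlgCl ℓ] locConv ℓ n :=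
  AlgEquiv.ofAlgHom (scaleHom fun i => (α i : PadicAlgCl ℓ))
    (scaleHom fun i => ((α i)⁻¹ : (PadicAlgCl ℓ)ˣ))
    (scaleHom_comp _ _ (by ext i; simp)) (scaleHom_comp _ _ (by ext i; simp))

lemma phi_coord {n : ℕ} (α : Fin n → (PadicAlgCl ℓ)ˣ) (i : Fin n) :
    phi α (coord i) = (α i : PadicAlgCl ℓ) • coord i := by
  apply Subtype.ext
  change rescaleAlgHom (fun i => (α i : PadicAlgCl ℓ)) (X i) = (α i : PadicAlgCl ℓ) • X i
  rw [rescaleAlgHom_apply, rescale_eq_subst, subst_X (HasSubst.smul_X _)]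
  rfl

/-- `J` is a `φ`-ideal if `φ(J) = J`. -/
def IsPhiIdeal {n : ℕ} (φ : locConv ℓ n ≃ₐ[PadicAlgCl ℓ] locConv ℓ n)
    (J : Ideal (locConv ℓ n)) : Prop :=
  φ '' (J : Set (locConv ℓ n)) = J

lemma hasSubst_line {n : ℕ} (c : Fin n → PadicAlgCl ℓ) :
    HasSubst fun i => c i • (X 0 : MvPowerSeries (Fin 1) (PadicAlgCl ℓ)) :=
  hasSubst_of_constantCoeff_zero fun i => by simp

lemma IsLocallyConvergent.subst_line {n : ℕ} (c : Fin n → PadicAlgCl ℓ)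
    {f : MvPowerSeries (Fin n) (PadicAlgCl ℓ)} (hf : IsLocallyConvergent ℓ f) :
    IsLocallyConvergent ℓ (substAlgHom (R := PadicAlgCl ℓ) (hasSubst_line c) f) := by
  classical
  obtain ⟨⟨E, hE, hfE⟩, hr⟩ := hf
  obtain ⟨F, hF, hcF⟩ := exists_finite_mem c
  obtain ⟨r, hr, B, hB, h⟩ := (exists_isRestricted_iff f).1 hr
  obtain ⟨L, hL, hcL⟩ := exists_norm_bound c
  have key : ∀ (d : Fin n →₀ ℕ) (e : Fin 1 →₀ ℕ),
      coeff e (d.prod fun i k => (c i • (X 0 : MvPowerSeries (Fin 1) (PadicAlgCl ℓ))) ^ k) =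
        if e.degree = d.degree then d.prod fun i k => c i ^ k else 0 := by
    intro d e
    have h1 : (d.prod fun i k => (c i • (X 0 : MvPowerSeries (Fin 1) (PadicAlgCl ℓ))) ^ k) =
        (d.prod fun i k => c i ^ k) • X 0 ^ d.degree := by
      simp only [smul_pow, Finsupp.prod, Finset.prod_smul, Finset.prod_pow_eq_pow_sum,
        Finsupp.degree_apply]
    have h2 : e = Finsupp.single 0 d.degree ↔ e.degree = d.degree := by
      constructor
      · intro h; rw [h]; simp
      · intro h
        ext
        simpa [Finsupp.degree_eq_sum] using h
    rw [h1, coeff_smul, coeff_X_pow]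
    simp [h2]
  refine ⟨⟨E ⊔ F, inferInstance, fun e => ?_⟩, (exists_isRestricted_iff _).2
    ⟨r / L, by positivity, B, hB, fun e => ?_⟩⟩
  · rw [substAlgHom_apply, coeff_subst (hasSubst_line c)]
    refine finsum_induction (· ∈ E ⊔ F) (zero_mem _) (fun _ _ => add_mem) fun d => ?_
    rw [key]
    split_ifs
    · exact mul_mem ((le_sup_left : E ≤ E ⊔ F) (hfE d))
        ((le_sup_right : F ≤ E ⊔ F) (prod_pow_mem hcF d))
    · rw [smul_zero]; exact zero_mem _
  · rw [substAlgHom_apply, coeff_subst (hasSubst_line c), ← le_div_iff₀ (by positivity)]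
    have h0 : 0 ≤ B / (r / L) ^ e.degree := by positivity
    refine finsum_induction (fun x => ‖x‖ ≤ B / (r / L) ^ e.degree) (by simpa using h0)
      (fun x y hx hy => (IsUltrametricDist.norm_add_le_max x y).trans (max_le hx hy)) fun d => ?_
    rw [key]
    split_ifs with hd
    · rw [hd, le_div_iff₀ (by positivity), smul_eq_mul, norm_mul]
      calc _ ≤ ‖coeff d f‖ * L ^ d.degree * (r / L) ^ d.degree := by gcongr; exact hcL d
        _ = ‖coeff d f‖ * r ^ d.degree := by
          rw [div_pow]; field_simp
        _ ≤ B := h d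
    · simpa using h0

/-- The evaluation homomorphism `x_i ↦ c_i x` to the ring of locally convergent power series in
the single variable `x`. -/
noncomputable def evalLine {n : ℕ} (c : Fin n → PadicAlgCl ℓ) :
    locConv ℓ n →ₐ[PadicAlgCl ℓ] locConv ℓ 1 :=
  ((substAlgHom (hasSubst_line c)).comp (locConv ℓ n).val).codRestrict (locConv ℓ 1)
    fun f => IsLocallyConvergent.subst_line c f.2

lemma evalLine_coord {n : ℕ} (c : Fin n → PadicAlgCl ℓ) (i : Fin n) :
    evalLine c (coord i) = c i • coord 0 := by
  apply Subtype.ext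
  change substAlgHom (R := PadicAlgCl ℓ) (hasSubst_line c) (X i) = c i • X 0
  rw [substAlgHom_X]

end Rings

end LocConv

/-! Monomials are eigenvectors of `φ`. As every `α i` has archimedean absolute value `p ^ (w / 2) >
1`, the eigenvalue of a monomial determines its degree, so each `f ∈ I` splits into polynomial
components indexed by degree and eigenvalue. Lagrange interpolation in `φ` isolates a component
modulo any power of `m`, so the components lie in `I + m ^ N` for all `N` (`aeval_component_mem`).

If the components vanished together only at the origin, the Nullstellensatz would put some `m ^ K`
in the ideal they generate, hence in `I + m ^ (K + 1)`; Nakayama gives `m ^ K ≤ I`, and primality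
gives `I = m`. So there is a common zero `c ≠ 0` (`exists_common_zero`).

Take `c` of minimal support. If `α i / α j` had infinite order for some `i`, `j` in the support, a
homomorphism to `ℚ` separating `α i` from `α j` would define weights for which all components are
homogeneous, and the limit of `c` under the corresponding torus action would be a common zero of
smaller support. So these ratios are roots of unity, and a power of `φ` equalizes the `α i` on the
support. Restricting `f` to the line through `c` gives a series whose coefficients are sums of
component values at `c`, hence zero. -/

namespace LocConv

open MvPowerSeries

/-! ### Powers of the maximal ideal, and its inclusion in the Jacobson radical -/

section LocalRing

variable {ℓ : ℕ} [Fact ℓ.Prime] {n : ℕ}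

/-- The part of `f` made of the monomials whose first variable is `x_i`, divided by `x_i`. -/
noncomputable def divCoord (i : Fin n) (f : MvPowerSeries (Fin n) (PadicAlgCl ℓ)) :
    MvPowerSeries (Fin n) (PadicAlgCl ℓ) := by
  classical
  exact fun d => if ∀ j < i, d j = 0 then coeff (d + Finsupp.single i 1) f else 0

lemma coeff_divCoord [DecidableEq (Fin n)] (i : Fin n)
    (f : MvPowerSeries (Fin n) (PadicAlgCl ℓ)) (d : Fin n →₀ ℕ) :
    coeff d (divCoord i f) = if ∀ j < i, d j = 0 then coeff (d + Finsupp.single i 1) f else 0 := by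
  simp only [divCoord, coeff_apply]

lemma IsLocallyConvergent.divCoord (i : Fin n) {f : MvPowerSeries (Fin n) (PadicAlgCl ℓ)}
    (hf : IsLocallyConvergent ℓ f) : IsLocallyConvergent ℓ (divCoord i f) := by
  obtain ⟨⟨E, hE, hfE⟩, hr⟩ := hf
  obtain ⟨r, hr, B, hB, h⟩ := (exists_isRestricted_iff f).1 hr
  refine ⟨⟨E, hE, fun d => ?_⟩, (exists_isRestricted_iff _).2
    ⟨r, hr, B / r, by positivity, fun d => ?_⟩⟩
  · rw [coeff_divCoord]
    split_ifs
    · exact hfE _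
    · exact zero_mem E
  · rw [coeff_divCoord]
    split_ifs
    · have := h (d + Finsupp.single i 1)
      rw [map_add, Finsupp.degree_single, pow_succ] at this
      rw [le_div_iff₀ hr]
      linarith
    · simpa using div_nonneg hB hr.le

/-- Each nonconstant monomial is divisible by a unique first variable, so it is counted exactly
once. -/
lemma sum_X_mul_divCoord {f : MvPowerSeries (Fin n) (PadicAlgCl ℓ)} (hf : coeff 0 f = 0) :
    ∑ i, X i * divCoord i f = f := by
  classical
  ext d
  rw [map_sum]
  simp only [X_def, coeff_monomial_mul, coeff_divCoord, one_mul]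
  by_cases hd : d = 0
  · subst hd
    rw [hf]
    refine Finset.sum_eq_zero fun i _ => if_neg fun h => ?_
    simpa using h i
  have hs : d.support.Nonempty := Finsupp.support_nonempty_iff.2 hd
  set i := d.support.min' hs with hi
  have hdi : d i ≠ 0 := Finsupp.mem_support_iff.1 (Finset.min'_mem _ _)
  have hlt : ∀ j < i, d j = 0 := fun j hj => by
    by_contra h
    exact absurd (Finset.min'_le _ j (Finsupp.mem_support_iff.2 h)) (not_le.2 hj)
  have hle : ∀ j, Finsupp.single j 1 ≤ d ↔ d j ≠ 0 := fun j => by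
    rw [Finsupp.single_le_iff, Nat.one_le_iff_ne_zero]
  rw [Finset.sum_eq_single i]
  · rw [if_pos ((hle i).2 hdi), if_pos, tsub_add_cancel_of_le ((hle i).2 hdi)]
    intro j hj
    simp [hlt j hj]
  · intro j _ hji
    split_ifs with h1 h2
    · rw [hle] at h1
      rcases lt_or_gt_of_ne hji with h | h
      · exact absurd (hlt j h) h1
      · have := h2 i h
        simp [hji] at this
        exact absurd this hdi
    · rfl
    · rfl
  · simp

/-- Splitting off first variables stays inside the convergent series and lowers the order of
vanishing by one; iterate. -/
lemma mem_maxIdeal_pow {N : ℕ} (f : locConv ℓ n)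
    (h : ∀ d : Fin n →₀ ℕ, d.degree < N →
      coeff d (f : MvPowerSeries (Fin n) (PadicAlgCl ℓ)) = 0) :
    f ∈ maxIdeal ℓ n ^ N := by
  classical
  induction N generalizing f with
  | zero => simp
  | succ N ih =>
    have hf : f = ∑ i, coord i * ⟨divCoord i f.1, f.2.divCoord i⟩ := by
      apply Subtype.ext
      rw [AddSubmonoidClass.coe_finsetSum]
      exact (sum_X_mul_divCoord (h 0 (by simp))).symm
    rw [hf, pow_succ']
    refine sum_mem fun i _ => Ideal.mul_mem_mul (Ideal.subset_span ⟨i, rfl⟩) (ih _ fun d hd => ?_)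
    change coeff d (divCoord i f.1) = 0
    rw [coeff_divCoord]
    split_ifs
    · exact h _ (by simpa using hd)
    · rfl

lemma coeff_zero_of_mem_maxIdeal {f : locConv ℓ n} (hf : f ∈ maxIdeal ℓ n) :
    coeff 0 (f : MvPowerSeries (Fin n) (PadicAlgCl ℓ)) = 0 := by
  let ψ : locConv ℓ n →+* PadicAlgCl ℓ :=
    (constantCoeff (σ := Fin n) (R := PadicAlgCl ℓ)).comp (locConv ℓ n).val.toRingHom
  have hle : maxIdeal ℓ n ≤ RingHom.ker ψ := by
    refine Ideal.span_le.2 ?_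
    rintro _ ⟨i, rfl⟩
    exact constantCoeff_X i
  exact hle hf

/-- The inverse satisfies `g = 1 + g * u`, which determines its coefficients recursively by degree.
On a small enough polydisc the terms of `u` have norm at most `1`, and the ultrametric inequality
passes this bound on to `g`. -/
lemma IsLocallyConvergent.inv_one_sub {u : MvPowerSeries (Fin n) (PadicAlgCl ℓ)}
    (hu : IsLocallyConvergent ℓ u) (hu0 : coeff 0 u = 0) :
    IsLocallyConvergent ℓ (1 - u)⁻¹ := by
  classical
  obtain ⟨⟨E, hE, huE⟩, hr⟩ := hu
  obtain ⟨r, hr, B, hB, h⟩ := (exists_isRestricted_iff u).1 hr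
  set g := (1 - u)⁻¹ with hg
  have hgu : g = 1 + g * u := by
    have : g * (1 - u) = 1 := MvPowerSeries.inv_mul_cancel _ (by
      rw [map_sub, ← coeff_zero_eq_constantCoeff_apply u, hu0]; simp)
    linear_combination this
  have hrec : ∀ d, coeff d g =
      (if d = 0 then 1 else 0) + ∑ q ∈ Finset.HasAntidiagonal.antidiagonal d, coeff q.1 g * coeff q.2 u := by
    intro d
    conv_lhs => rw [hgu]
    rw [map_add, coeff_one, coeff_mul]
  have hlt : ∀ d : Fin n →₀ ℕ, ∀ q ∈ Finset.HasAntidiagonal.antidiagonal d, q.2 ≠ 0 → q.1.degree < d.degree := by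
    intro d q hq hq2
    rw [← Finset.HasAntidiagonal.mem_antidiagonal.1 hq, map_add]
    have : q.2.degree ≠ 0 := (Finsupp.degree_eq_zero_iff _).not.2 hq2
    lia
  -- Since `u` has no constant term, each term gains at least one factor `1 / (B + 1)`, which
  -- absorbs the bound `B`.
  set s := r / (B + 1) with hs
  have hs0 : 0 < s := by positivity
  have hus : ∀ d, d ≠ 0 → ‖coeff d u‖ * s ^ d.degree ≤ 1 := by
    intro d hd
    have hd' : d.degree ≠ 0 := (Finsupp.degree_eq_zero_iff _).not.2 hd
    rw [hs, div_pow, ← mul_div_assoc, div_le_one (by positivity)]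
    calc _ ≤ B := h d
      _ ≤ B + 1 := by linarith
      _ ≤ (B + 1) ^ d.degree := le_self_pow₀ (by linarith) hd'
  refine ⟨⟨E, hE, ?_⟩, (exists_isRestricted_iff _).2 ⟨s, hs0, 1, zero_le_one, ?_⟩⟩
  · intro d
    induction hk : d.degree using Nat.strong_induction_on generalizing d with
    | _ k ih =>
    subst hk
    rw [hrec]
    refine add_mem (by split_ifs <;> simp) (sum_mem fun q hq => ?_)
    by_cases hq2 : q.2 = 0
    · rw [hq2, hu0, mul_zero]; exact zero_mem E
    · exact mul_mem (ih _ (hlt d q hq hq2) _ rfl) (huE _)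
  · intro d
    induction hk : d.degree using Nat.strong_induction_on generalizing d with
    | _ k ih =>
    rw [← le_div_iff₀ (by positivity)]
    subst hk
    rw [hrec]
    refine (IsUltrametricDist.norm_add_le_max _ _).trans (max_le ?_ ?_)
    · split_ifs with hd
      · simp [hd]
      · simp only [norm_zero]; positivity
    · refine IsUltrametricDist.norm_sum_le_of_forall_le_of_nonneg (by positivity) fun q hq => ?_
      by_cases hq2 : q.2 = 0
      · rw [hq2, hu0, mul_zero, norm_zero]; positivity
      · rw [le_div_iff₀ (by positivity), ← Finset.HasAntidiagonal.mem_antidiagonal.1 hq, map_add, pow_add, norm_mul]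
        calc _ = (‖coeff q.1 g‖ * s ^ q.1.degree) * (‖coeff q.2 u‖ * s ^ q.2.degree) := by ring
          _ ≤ 1 := mul_le_one₀ (ih _ (hlt d q hq hq2) _ rfl) (by positivity) (hus _ hq2)

lemma maxIdeal_le_jacobson : maxIdeal ℓ n ≤ (⊥ : Ideal (locConv ℓ n)).jacobson := by
  intro f hf
  refine Ideal.mem_jacobson_bot.2 fun y => ?_
  have h0 := coeff_zero_of_mem_maxIdeal (neg_mem (Ideal.mul_mem_right y _ hf))
  have hmem := (-(f * y)).2
  refine IsUnit.of_mul_eq_one ⟨_, IsLocallyConvergent.inv_one_sub hmem h0⟩ (Subtype.ext ?_)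
  have key : (1 - ((-(f * y) : locConv ℓ n) : MvPowerSeries (Fin n) (PadicAlgCl ℓ))) *
      (1 - ((-(f * y) : locConv ℓ n) : MvPowerSeries (Fin n) (PadicAlgCl ℓ)))⁻¹ = 1 := by
    refine MvPowerSeries.mul_inv_cancel _ ?_
    rw [map_sub, ← coeff_zero_eq_constantCoeff_apply (Subtype.val _), h0]; simp
  refine Eq.trans ?_ key
  rw [show (((f * y + 1) * _ : locConv ℓ n) : MvPowerSeries (Fin n) (PadicAlgCl ℓ)) =
    ((f : MvPowerSeries (Fin n) (PadicAlgCl ℓ)) * y + 1) * _ from rfl]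
  congr 1
  rw [NegMemClass.coe_neg, MulMemClass.coe_mul]
  ring

lemma maxIdeal_fg : (maxIdeal ℓ n).FG :=
  Submodule.fg_span (Set.finite_range _)

end LocalRing

/-! ### Eigencomponents and their common zeros -/

section Components

variable {ℓ : ℕ} [Fact ℓ.Prime] {n : ℕ}

lemma mem_finsuppAntidiag_univ {k : ℕ} {d : Fin n →₀ ℕ} :
    d ∈ (Finset.univ : Finset (Fin n)).finsuppAntidiag k ↔ d.degree = k := by
  simp [Finset.mem_finsuppAntidiag, Finsupp.degree_eq_sum]

open Classical in
/-- The part of `f` made of the monomials of degree `k` on which the substitution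
`x_i ↦ a_i x_i` acts by the scalar `χ`. -/
noncomputable def component {F : Type*} [Field F] (a : Fin n → F) (k : ℕ) (χ : F)
    (f : MvPowerSeries (Fin n) F) : MvPolynomial (Fin n) F :=
  ∑ d ∈ Finset.univ.finsuppAntidiag k with (d.prod fun i m => a i ^ m) = χ,
    MvPolynomial.monomial d (coeff d f)

open Classical in
lemma coeff_component {F : Type*} [Field F] (a : Fin n → F) (k : ℕ) (χ : F)
    (f : MvPowerSeries (Fin n) F) (d : Fin n →₀ ℕ) :
    MvPolynomial.coeff d (component a k χ f) =
      if d.degree = k ∧ (d.prod fun i m => a i ^ m) = χ then coeff d f else 0 := by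
  rw [component, MvPolynomial.coeff_sum]
  simp only [MvPolynomial.coeff_monomial]
  rw [Finset.sum_ite_eq']
  simp only [Finset.mem_filter, mem_finsuppAntidiag_univ]

open Classical in
lemma aeval_component {F : Type*} [Field F] (a : Fin n → F) (k : ℕ) (χ : F)
    (f : MvPowerSeries (Fin n) F) (c : Fin n → F) :
    MvPolynomial.aeval c (component a k χ f) =
      ∑ d ∈ Finset.univ.finsuppAntidiag k with (d.prod fun i m => a i ^ m) = χ,
        coeff d f * d.prod fun i m => c i ^ m := by
  rw [component, map_sum]
  simp only [MvPolynomial.aeval_monomial, Algebra.algebraMap_self, RingHom.id_apply]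

lemma coe_aeval_coord (q : MvPolynomial (Fin n) (PadicAlgCl ℓ)) :
    ((MvPolynomial.aeval coord q : locConv ℓ n) : MvPowerSeries (Fin n) (PadicAlgCl ℓ)) = q := by
  have : (locConv ℓ n).val.comp (MvPolynomial.aeval coord) =
      MvPolynomial.coeToMvPowerSeries.algHom (PadicAlgCl ℓ) := by
    ext1 i
    simp [coord]
  simpa using DFunLike.congr_fun this q

lemma coeff_scaleHom_pow (a : Fin n → PadicAlgCl ℓ) (k : ℕ) (f : locConv ℓ n) (d : Fin n →₀ ℕ) :
    coeff d (((scaleHom a).toLinearMap ^ k) f : locConv ℓ n).1 =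
      (d.prod fun i m => a i ^ m) ^ k * coeff d f.1 := by
  induction k with
  | zero => simp
  | succ k ih =>
    rw [pow_succ', Module.End.mul_apply]
    change coeff d (rescaleAlgHom a (((scaleHom a).toLinearMap ^ k) f : locConv ℓ n).1) = _
    rw [rescaleAlgHom_apply, coeff_rescale, ih]
    ring

/-- A polynomial in a diagonal operator acts on each monomial through its value at the eigenvalue.
-/
lemma coeff_aeval_scaleHom (a : Fin n → PadicAlgCl ℓ) (P : Polynomial (PadicAlgCl ℓ))
    (f : locConv ℓ n) (d : Fin n →₀ ℕ) :
    coeff d (Polynomial.aeval (scaleHom a).toLinearMap P f : locConv ℓ n).1 =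
      P.eval (d.prod fun i m => a i ^ m) * coeff d f.1 := by
  induction P using Polynomial.induction_on' with
  | add P Q hP hQ =>
    rw [map_add, LinearMap.add_apply, Polynomial.eval_add, add_mul, ← hP, ← hQ]
    exact map_add (coeff d) _ _
  | monomial k b =>
    rw [Polynomial.aeval_monomial, Polynomial.eval_monomial, Module.algebraMap_end_eq_smul_id,
      mul_assoc, ← coeff_scaleHom_pow]
    exact coeff_smul _ _ _

lemma aeval_scaleHom_mem {a : Fin n → PadicAlgCl ℓ} {I : Ideal (locConv ℓ n)}
    (hI : ∀ f ∈ I, scaleHom a f ∈ I) (P : Polynomial (PadicAlgCl ℓ)) {f : locConv ℓ n}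
    (hf : f ∈ I) : Polynomial.aeval (scaleHom a).toLinearMap P f ∈ I := by
  induction P using Polynomial.induction_on' with
  | add P Q hP hQ => rw [map_add]; exact add_mem hP hQ
  | monomial k b =>
    rw [Polynomial.aeval_monomial, Module.algebraMap_end_eq_smul_id]
    refine (I.restrictScalars (PadicAlgCl ℓ)).smul_mem b ?_
    change ((scaleHom a).toLinearMap ^ k) f ∈ I
    induction k with
    | zero => exact hf
    | succ k ih => rw [pow_succ', Module.End.mul_apply]; exact hI _ ih

/-- Only finitely many eigenvalues occur in degrees up to `N`, so a polynomial in the substitution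
can project onto the `χ`-part up to an error in `m ^ N`. -/
lemma aeval_component_mem {a : Fin n → PadicAlgCl ℓ}
    (ha : ∀ d e : Fin n →₀ ℕ, (d.prod fun i m => a i ^ m) = (e.prod fun i m => a i ^ m) →
      d.degree = e.degree)
    {I : Ideal (locConv ℓ n)} (hI : ∀ f ∈ I, scaleHom a f ∈ I) {f : locConv ℓ n} (hf : f ∈ I)
    (k : ℕ) (χ : PadicAlgCl ℓ) (N : ℕ) :
    MvPolynomial.aeval coord (component a k χ f.1) ∈ I ⊔ maxIdeal ℓ n ^ N := by
  classical
  -- The hypothesis `ha` only compares monomials: a monomial `e` realizing `(k, χ)` is needed to tie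
  -- `χ` to the degree `k`.
  by_cases he : ∃ e : Fin n →₀ ℕ, e.degree = k ∧ (e.prod fun i m => a i ^ m) = χ
  swap
  · have : component a k χ f.1 = 0 := by
      ext d
      rw [coeff_component, if_neg fun h => he ⟨d, h⟩, MvPolynomial.coeff_zero]
    rw [this, map_zero]
    exact zero_mem _
  obtain ⟨e, hek, heχ⟩ := he
  -- The interpolation nodes: `P` is `1` at `χ` and `0` at every other eigenvalue in degree at most
  -- `N`.
  set X : Finset (PadicAlgCl ℓ) := insert χ
    ((finite_degree_le n N).toFinset.image fun d => d.prod fun i m => a i ^ m) with hX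
  set P := Lagrange.basis X id χ with hP
  set g := Polynomial.aeval (scaleHom a).toLinearMap P f with hg
  rw [← add_sub_cancel g (MvPolynomial.aeval coord (component a k χ f.1))]
  refine add_mem (Ideal.mem_sup_left (aeval_scaleHom_mem hI P hf))
    (Ideal.mem_sup_right (mem_maxIdeal_pow _ fun d hd => ?_))
  rw [AddSubgroupClass.coe_sub, map_sub, coe_aeval_coord, MvPolynomial.coeff_coe, coeff_component,
    hg, coeff_aeval_scaleHom]
  by_cases hdχ : (d.prod fun i m => a i ^ m) = χ
  · have h1 : P.eval χ = 1 := Lagrange.eval_basis_self (v := id) Function.injective_id.injOn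
      (Finset.mem_insert_self _ _)
    rw [if_pos ⟨(ha d e (hdχ.trans heχ.symm)).trans hek, hdχ⟩, hdχ, h1, one_mul, sub_self]
  · have h0 : P.eval (d.prod fun i m => a i ^ m) = 0 :=
      Lagrange.eval_basis_of_ne (v := id) (Ne.symm hdχ) (Finset.mem_insert_of_mem
        (Finset.mem_image_of_mem _ ((Set.Finite.mem_toFinset _).2 hd.le)))
    rw [if_neg fun h => hdχ h.2, h0, zero_mul, sub_zero]

lemma exists_common_zero {a : Fin n → PadicAlgCl ℓ}
    (ha : ∀ d e : Fin n →₀ ℕ, (d.prod fun i m => a i ^ m) = (e.prod fun i m => a i ^ m) →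
      d.degree = e.degree)
    {I : Ideal (locConv ℓ n)} (hI : ∀ f ∈ I, scaleHom a f ∈ I) (hp : I.IsPrime)
    (hle : I ≤ maxIdeal ℓ n) (hne : I ≠ maxIdeal ℓ n) :
    ∃ c : Fin n → PadicAlgCl ℓ, c ≠ 0 ∧
      ∀ f ∈ I, ∀ k χ, MvPolynomial.aeval c (component a k χ f.1) = 0 := by
  by_contra! hc
  set S : Set (MvPolynomial (Fin n) (PadicAlgCl ℓ)) :=
    {q | ∃ f ∈ I, ∃ k χ, q = component a k χ f.1} with hS
  -- Nullstellensatz: every coordinate vanishes on the zero locus of `S`, which is contained in the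
  -- origin.
  have hX : ∀ i, MvPolynomial.X i ∈ (Ideal.span S).radical := fun i => by
    rw [← MvPolynomial.vanishingIdeal_zeroLocus_eq_radical (K := PadicAlgCl ℓ),
      MvPolynomial.mem_vanishingIdeal_iff]
    intro c hcS
    rw [MvPolynomial.aeval_X]
    by_contra hci
    obtain ⟨f, hf, k, χ, h⟩ := hc c fun h => hci (congrFun h i)
    exact h (MvPolynomial.mem_zeroLocus_iff.1 hcS _ (Ideal.subset_span ⟨f, hf, k, χ, rfl⟩))
  set J : Ideal (locConv ℓ n) := (Ideal.span S).map (MvPolynomial.aeval coord) with hJ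
  have hJI : ∀ N, J ≤ I ⊔ maxIdeal ℓ n ^ N := fun N => by
    rw [hJ, Ideal.map_le_iff_le_comap, Ideal.span_le]
    rintro _ ⟨f, hf, k, χ, rfl⟩
    exact aeval_component_mem ha hI hf k χ N
  have hmJ : maxIdeal ℓ n ≤ J.radical := by
    refine Ideal.span_le.2 ?_
    rintro _ ⟨i, rfl⟩
    obtain ⟨m, hm⟩ := hX i
    refine ⟨m, ?_⟩
    have := Ideal.mem_map_of_mem (MvPolynomial.aeval (coord (ℓ := ℓ))) hm
    rwa [map_pow, MvPolynomial.aeval_X] at this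
  obtain ⟨K, hK⟩ := Ideal.exists_pow_le_of_le_radical_of_fg hmJ maxIdeal_fg
  -- Nakayama, applied to `m ^ K ≤ I ⊔ m * m ^ K`; this is the inclusion `hJI` with `N = K + 1`.
  have hKI : maxIdeal ℓ n ^ K ≤ I := by
    refine Submodule.le_of_le_smul_of_le_jacobson_bot (maxIdeal_fg.pow) maxIdeal_le_jacobson ?_
    rw [smul_eq_mul, ← pow_succ']
    exact hK.trans (hJI _)
  exact hne (le_antisymm hle (hp.le_of_pow_le hKI))

end Components

/-! ### Shrinking the support of a common zero -/

/-- Tensoring with `ℚ` kills only torsion, and linear forms separate the points of a `ℚ`-vector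
space. -/
lemma exists_addMonoidHom_rat_ne_zero {G : Type*} [CommGroup G] {x : G} (hx : ¬ IsOfFinOrder x) :
    ∃ v : Additive G →+ ℚ, v (Additive.ofMul x) ≠ 0 := by
  have h : TensorProduct.mk ℤ ℚ (Additive G) 1 (Additive.ofMul x) ≠ 0 := by
    intro h
    obtain ⟨s, hs⟩ := (IsLocalizedModule.eq_zero_iff (nonZeroDivisors ℤ) _).1 h
    refine hx (isOfFinOrder_iff_zpow_eq_one.2 ⟨s, nonZeroDivisors.coe_ne_zero s, ?_⟩)
    exact Additive.ofMul.injective hs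
  obtain ⟨φ, hφ⟩ : ∃ φ : Module.Dual ℚ (TensorProduct ℤ ℚ (Additive G)),
      φ (TensorProduct.mk ℤ ℚ (Additive G) 1 (Additive.ofMul x)) ≠ 0 := by
    by_contra! hφ
    exact h ((Module.forall_dual_apply_eq_zero_iff ℚ _).1 hφ)
  exact ⟨φ.toAddMonoidHom.comp (TensorProduct.mk ℤ ℚ (Additive G) 1).toAddMonoidHom, hφ⟩

/-- A common zero of the components of `f` degenerates, along any weights for which the components
are homogeneous, to its part of least weight. -/
lemma aeval_component_initial_eq_zero {F : Type*} [Field F] {n : ℕ} {a : Fin n → F} {v : Fin n → ℚ}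
    (hv : ∀ d e : Fin n →₀ ℕ, (d.prod fun i m => a i ^ m) = (e.prod fun i m => a i ^ m) →
      ∑ i, d i * v i = ∑ i, e i * v i)
    {c : Fin n → F} {r : ℚ} (hr : ∀ i, c i ≠ 0 → r ≤ v i) {f : MvPowerSeries (Fin n) F}
    {k : ℕ} {χ : F} (hc : MvPolynomial.aeval c (component a k χ f) = 0) :
    MvPolynomial.aeval (fun i => if v i = r then c i else 0) (component a k χ f) = 0 := by
  classical
  rw [aeval_component] at hc ⊢
  set c' : Fin n → F := fun i => if v i = r then c i else 0 with hc'
  -- A monomial `e` that survives at `c'` involves only variables of weight `r`, which forces the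
  -- weight of the whole component to be `k * r`.
  by_cases h : ∃ e : Fin n →₀ ℕ, e.degree = k ∧ (e.prod fun i m => a i ^ m) = χ ∧
      (e.prod fun i m => c' i ^ m) ≠ 0
  swap
  · refine Finset.sum_eq_zero fun d hd => ?_
    rw [Finset.mem_filter, mem_finsuppAntidiag_univ] at hd
    by_contra h0
    exact h ⟨d, hd.1, hd.2, right_ne_zero_of_mul h0⟩
  obtain ⟨e, hek, heχ, he⟩ := h
  have hev : ∑ i, (e i : ℚ) * (v i - r) = 0 := by
    refine Finset.sum_eq_zero fun i _ => ?_
    by_cases hi : e i = 0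
    · simp [hi]
    · have := Finset.prod_ne_zero_iff.1 he i (Finsupp.mem_support_iff.2 hi)
      by_cases hvi : v i = r
      · simp [hvi]
      · simp [hc', hvi, hi] at this
  refine Eq.trans ?_ hc
  refine Finset.sum_congr rfl fun d hd => ?_
  rw [Finset.mem_filter, mem_finsuppAntidiag_univ] at hd
  congr 1
  by_cases hd0 : ∃ i, d i ≠ 0 ∧ c i = 0
  · obtain ⟨i, hi, hci⟩ := hd0
    rw [Finsupp.prod, Finsupp.prod, Finset.prod_eq_zero (Finsupp.mem_support_iff.2 hi)
        (show c' i ^ d i = 0 by simp [hc', hci, hi]),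
      Finset.prod_eq_zero (Finsupp.mem_support_iff.2 hi) (show c i ^ d i = 0 by simp [hci, hi])]
  push Not at hd0
  -- A monomial nonzero at `c` has this same minimal weight, and its variables all have weight at
  -- least `r`; hence they all have weight exactly `r`, where `c'` and `c` agree.
  have hdv : ∑ i, (d i : ℚ) * (v i - r) = 0 := by
    rw [← hev]
    simp only [mul_sub, Finset.sum_sub_distrib, ← Finset.sum_mul]
    rw [hv d e (hd.2.trans heχ.symm)]
    congr 2
    have := hd.1.trans hek.symm
    rw [Finsupp.degree_eq_sum, Finsupp.degree_eq_sum] at this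
    exact_mod_cast this
  have hnn : ∀ i ∈ Finset.univ, 0 ≤ (d i : ℚ) * (v i - r) := fun i _ => by
    by_cases hi : d i = 0
    · simp [hi]
    · exact mul_nonneg (Nat.cast_nonneg _) (sub_nonneg.2 (hr i (hd0 i hi)))
  refine Finset.prod_congr rfl fun i hi => ?_
  have h0 := (Finset.sum_eq_zero_iff_of_nonneg hnn).1 hdv i (Finset.mem_univ _)
  have hdi : (d i : ℚ) ≠ 0 := Nat.cast_ne_zero.2 (Finsupp.mem_support_iff.1 hi)
  have hvi : v i = r := sub_eq_zero.1 ((mul_eq_zero.1 h0).resolve_left hdi)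
  simp [hvi]

/-- A common zero of minimal support works: a ratio of infinite order would allow a degeneration to
a smaller support. -/
lemma exists_common_zero_isOfFinOrder_div {F : Type*} [Field F] {n : ℕ} (α : Fin n → Fˣ)
    (T : Set (MvPowerSeries (Fin n) F)) {c₀ : Fin n → F} (hc₀ : c₀ ≠ 0)
    (h₀ : ∀ f ∈ T, ∀ k χ, MvPolynomial.aeval c₀ (component (fun i => (α i : F)) k χ f) = 0) :
    ∃ c : Fin n → F, c ≠ 0 ∧
      (∀ f ∈ T, ∀ k χ, MvPolynomial.aeval c (component (fun i => (α i : F)) k χ f) = 0) ∧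
      ∀ i j, c i ≠ 0 → c j ≠ 0 → IsOfFinOrder (α i / α j) := by
  classical
  let Z : Set (Fin n → F) := {c | c ≠ 0 ∧
    ∀ f ∈ T, ∀ k χ, MvPolynomial.aeval c (component (fun i => (α i : F)) k χ f) = 0}
  let supp : (Fin n → F) → Finset (Fin n) := fun c => Finset.univ.filter fun i => c i ≠ 0
  obtain ⟨c, ⟨hc0, hc⟩, hmin⟩ : ∃ c ∈ Z, ∀ c' ∈ Z, ¬ supp c' < supp c := by
    obtain ⟨c, hc, h⟩ := (InvImage.wf supp wellFounded_lt).has_min Z ⟨c₀, hc₀, h₀⟩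
    exact ⟨c, hc, h⟩
  refine ⟨c, hc0, hc, fun i j hi hj => ?_⟩
  by_contra hij
  obtain ⟨v, hv⟩ := exists_addMonoidHom_rat_ne_zero hij
  set u : Fin n → ℚ := fun i => v (Additive.ofMul (α i)) with hu
  have hne : u i ≠ u j := by
    rw [ofMul_div, map_sub, sub_ne_zero] at hv
    exact hv
  have hsum : ∀ d e : Fin n →₀ ℕ,
      (d.prod fun i m => (α i : F) ^ m) = (e.prod fun i m => (α i : F) ^ m) →
        ∑ i, d i * u i = ∑ i, e i * u i := by
    have key : ∀ d : Fin n →₀ ℕ, ∑ i, d i * u i = v (Additive.ofMul (∏ i, α i ^ d i)) := by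
      intro d
      rw [ofMul_prod, map_sum]
      simp [hu]
    intro d e hde
    rw [key, key]
    congr 2
    rw [Finsupp.prod_fintype _ _ (by simp), Finsupp.prod_fintype _ _ (by simp)] at hde
    apply Units.ext
    simpa using hde
  obtain ⟨m, hm, hmle⟩ := Finset.exists_min_image (supp c) u ⟨i, by simpa [supp] using hi⟩
  have hcm : c m ≠ 0 := by simpa [supp] using hm
  refine hmin (fun i => if u i = u m then c i else 0) ⟨?_, fun f hf k χ => ?_⟩ ?_
  · intro h
    simpa [hcm] using congrFun h m
  · exact aeval_component_initial_eq_zero hsum (fun l hl => hmle l (by simpa [supp] using hl))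
      (hc f hf k χ)
  -- As `u i ≠ u j`, at least one of `i`, `j` is not of least weight and drops out of the support.
  · rw [Finset.ssubset_iff_of_subset]
    · by_cases him : u i = u m
      · exact ⟨j, by simpa [supp] using hj, by simp [supp, ← him, hne.symm]⟩
      · exact ⟨i, by simpa [supp] using hi, by simp [supp, him]⟩
    · intro l
      simp only [supp, Finset.mem_filter, Finset.mem_univ, true_and]
      split_ifs <;> simp

/-! ### Restriction to a line -/

section EvalLine

variable {ℓ : ℕ} [Fact ℓ.Prime] {n : ℕ}

lemma coeff_evalLine (c : Fin n → PadicAlgCl ℓ) (f : locConv ℓ n) (e : Fin 1 →₀ ℕ) :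
    coeff e (evalLine c f).1 = ∑ d ∈ Finset.univ.finsuppAntidiag e.degree,
      coeff d f.1 * d.prod fun i m => c i ^ m := by
  classical
  change coeff e (substAlgHom (R := PadicAlgCl ℓ) (hasSubst_line c) f.1) = _
  have key : ∀ d : Fin n →₀ ℕ,
      coeff e (d.prod fun i k => (c i • (X 0 : MvPowerSeries (Fin 1) (PadicAlgCl ℓ))) ^ k) =
        if d.degree = e.degree then d.prod fun i k => c i ^ k else 0 := by
    intro d
    have h1 : (d.prod fun i k => (c i • (X 0 : MvPowerSeries (Fin 1) (PadicAlgCl ℓ))) ^ k) =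
        (d.prod fun i k => c i ^ k) • X 0 ^ d.degree := by
      simp only [smul_pow, Finsupp.prod, Finset.prod_smul, Finset.prod_pow_eq_pow_sum,
        Finsupp.degree_apply]
    have h2 : e = Finsupp.single 0 d.degree ↔ d.degree = e.degree := by
      constructor
      · intro h; rw [h]; simp
      · intro h
        ext
        simpa [Finsupp.degree_eq_sum] using h.symm
    rw [h1, coeff_smul, coeff_X_pow]
    simp [h2]
  rw [substAlgHom_apply, coeff_subst (hasSubst_line c)]
  simp only [key]
  rw [finsum_eq_sum_of_support_subset (s := Finset.univ.finsuppAntidiag e.degree)]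
  · refine Finset.sum_congr rfl fun d hd => ?_
    rw [if_pos (mem_finsuppAntidiag_univ.1 hd), smul_eq_mul]
  · intro d hd
    rw [Finset.mem_coe, mem_finsuppAntidiag_univ]
    by_contra h
    simp [h] at hd

/-- The coefficient of `x ^ k` is the sum over all `χ` of the values at `c` of the components of
degree `k`. -/
lemma evalLine_eq_zero {a c : Fin n → PadicAlgCl ℓ} {f : locConv ℓ n}
    (h : ∀ k χ, MvPolynomial.aeval c (component a k χ f.1) = 0) : evalLine c f = 0 := by
  classical
  apply Subtype.ext
  ext e
  rw [coeff_evalLine, ← Finset.sum_fiberwise_of_maps_to (g := fun d => d.prod fun i m => a i ^ m)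
    (fun d hd => Finset.mem_image_of_mem (fun d => d.prod fun i m => a i ^ m) hd)]
  refine Finset.sum_eq_zero fun χ _ => ?_
  rw [← aeval_component, h]

/-- The power series in `n` variables obtained from a power series in one variable by the
substitution `x ↦ b x_i`. -/
noncomputable def ofSingle (i : Fin n) (b : PadicAlgCl ℓ)
    (g : MvPowerSeries (Fin 1) (PadicAlgCl ℓ)) : MvPowerSeries (Fin n) (PadicAlgCl ℓ) := by
  classical
  exact fun d => if d = Finsupp.single i d.degree then
    b ^ d.degree * coeff (Finsupp.single 0 d.degree) g else 0

lemma coeff_ofSingle [DecidableEq (Fin n)] (i : Fin n) (b : PadicAlgCl ℓ)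
    (g : MvPowerSeries (Fin 1) (PadicAlgCl ℓ)) (d : Fin n →₀ ℕ) :
    coeff d (ofSingle i b g) = if d = Finsupp.single i d.degree then
      b ^ d.degree * coeff (Finsupp.single 0 d.degree) g else 0 := by
  simp only [ofSingle, coeff_apply]
  congr

lemma IsLocallyConvergent.ofSingle (i : Fin n) (b : PadicAlgCl ℓ)
    {g : MvPowerSeries (Fin 1) (PadicAlgCl ℓ)} (hg : IsLocallyConvergent ℓ g) :
    IsLocallyConvergent ℓ (ofSingle i b g) := by
  obtain ⟨⟨E, hE, hgE⟩, hr⟩ := hg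
  obtain ⟨D, hD, hbD⟩ := exists_finite_mem fun _ : Unit => b
  obtain ⟨r, hr, B, hB, h⟩ := (exists_isRestricted_iff g).1 hr
  have hL : 0 < ‖b‖ + 1 := by positivity
  refine ⟨⟨E ⊔ D, inferInstance, fun d => ?_⟩, (exists_isRestricted_iff _).2
    ⟨r / (‖b‖ + 1), by positivity, B, hB, fun d => ?_⟩⟩
  · rw [coeff_ofSingle]
    split_ifs
    · exact mul_mem (pow_mem ((le_sup_right : D ≤ E ⊔ D) (hbD ())) _)
        ((le_sup_left : E ≤ E ⊔ D) (hgE _))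
    · exact zero_mem _
  · rw [coeff_ofSingle]
    split_ifs
    · have h1 := h (Finsupp.single 0 d.degree)
      rw [Finsupp.degree_single] at h1
      rw [norm_mul, norm_pow]
      calc _ ≤ (‖b‖ + 1) ^ d.degree * ‖coeff (Finsupp.single 0 d.degree) g‖ *
            (r / (‖b‖ + 1)) ^ d.degree := by gcongr; linarith
        _ = ‖coeff (Finsupp.single 0 d.degree) g‖ * r ^ d.degree := by
          rw [div_pow]; field_simp
        _ ≤ B := h1
    · simpa using hB

/-- One nonzero `c i` suffices: `g(x_i / c i)` is a preimage of `g`. -/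
lemma evalLine_surjective {c : Fin n → PadicAlgCl ℓ} {i : Fin n} (hi : c i ≠ 0) :
    Function.Surjective (evalLine c) := by
  classical
  intro g
  refine ⟨⟨ofSingle i (c i)⁻¹ g.1, g.2.ofSingle i _⟩, Subtype.ext ?_⟩
  ext e
  rw [coeff_evalLine, Finset.sum_eq_single (Finsupp.single i e.degree)]
  · have he : Finsupp.single 0 e.degree = e := by
      ext
      simp [Finsupp.degree_eq_sum, Subsingleton.elim _ (0 : Fin 1)]
    rw [coeff_ofSingle, Finsupp.degree_single, if_pos rfl, Finsupp.prod_single_index (h := fun i m => c i ^ m) (pow_zero _), he,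
      mul_right_comm, ← mul_pow, inv_mul_cancel₀ hi, one_pow, one_mul]
  · intro d hd hne
    rw [mem_finsuppAntidiag_univ] at hd
    rw [coeff_ofSingle, hd, if_neg hne, zero_mul]
  · intro h
    rw [mem_finsuppAntidiag_univ, Finsupp.degree_single] at h
    exact absurd rfl h

end EvalLine

/-! ### Weil numbers: the eigenvalue determines the degree -/

section Weights

lemma IsWeilNumber.norm_algHom {p w : ℕ} {F : Type*} [Field F] [CharZero F] {x : F}
    (hx : IsWeilNumber p w x) (σ : algebraicClosure ℚ F →ₐ[ℚ] ℂ)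
    (hmem : x ∈ algebraicClosure ℚ F) : ‖σ ⟨x, hmem⟩‖ = (p : ℝ) ^ ((w : ℝ) / 2) := by
  obtain ⟨K, hK, b, rfl, -, hb⟩ := hx
  have : Algebra.IsAlgebraic ℚ K := Algebra.IsAlgebraic.of_finite ℚ K
  have hle : K ≤ algebraicClosure ℚ F := le_algebraicClosure ℚ F K
  have := hb (NumberField.InfinitePlace.mk
    (σ.comp (IntermediateField.inclusion hle)).toRingHom)
  exact this

lemma IsWeilNumber.mem_algebraicClosure {p w : ℕ} {F : Type*} [Field F] [CharZero F] {x : F}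
    (hx : IsWeilNumber p w x) : x ∈ algebraicClosure ℚ F := by
  obtain ⟨K, hK, b, rfl, -, -⟩ := hx
  have : Algebra.IsAlgebraic ℚ K := Algebra.IsAlgebraic.of_finite ℚ K
  exact le_algebraicClosure ℚ F K b.2

/-- Under an embedding into `ℂ` of the algebraic numbers of `F`, the eigenvalue of a monomial of
degree `k` has absolute value `q ^ k`, with `q = p ^ (w / 2) > 1`. -/
lemma degree_eq_of_prod_pow_eq {p w n : ℕ} (hp : 1 < p) (hw : 0 < w) {F : Type*} [Field F]
    [CharZero F] {a : Fin n → F} (ha : ∀ i, IsWeilNumber p w (a i)) {d e : Fin n →₀ ℕ}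
    (h : (d.prod fun i m => a i ^ m) = e.prod fun i m => a i ^ m) : d.degree = e.degree := by
  have : Algebra.IsAlgebraic ℚ (algebraicClosure ℚ F) := algebraicClosure.isAlgebraic ℚ F
  have σ : algebraicClosure ℚ F →ₐ[ℚ] ℂ := IsAlgClosed.lift
  let b : Fin n → algebraicClosure ℚ F := fun i => ⟨a i, (ha i).mem_algebraicClosure⟩
  set q : ℝ := (p : ℝ) ^ ((w : ℝ) / 2) with hq
  have hq1 : 1 < q := Real.one_lt_rpow (by exact_mod_cast hp) (by positivity)
  have key : ∀ d : Fin n →₀ ℕ, ‖σ (d.prod fun i m => b i ^ m)‖ = q ^ d.degree := by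
    intro d
    rw [Finsupp.prod, map_prod, norm_prod, Finsupp.degree_apply, ← Finset.prod_pow_eq_pow_sum]
    refine Finset.prod_congr rfl fun i _ => ?_
    rw [map_pow, norm_pow, (ha i).norm_algHom σ]
  have hb : (d.prod fun i m => b i ^ m) = e.prod fun i m => b i ^ m := by
    apply Subtype.ext
    simpa [Finsupp.prod, b] using h
  have := (key d).symm.trans ((congrArg (fun x => ‖σ x‖) hb).trans (key e))
  exact pow_right_injective₀ (by linarith) hq1.ne' this

end Weights

end LocConv

/-! ### The main theorem -/

theorem proposition4 (p ℓ : ℕ) [Fact p.Prime] [Fact ℓ.Prime] (hpℓ : ℓ ≠ p)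
    (w : ℕ) (hw : 0 < w) (n : ℕ) (α : Fin n → (PadicAlgCl ℓ)ˣ)
    (hα : ∀ i, LocConv.IsWeilNumber p w (α i : PadicAlgCl ℓ))
    (I : Ideal (LocConv.locConv ℓ n)) (hI : I.IsPrime)
    (hφ : LocConv.IsPhiIdeal (LocConv.phi α) I)
    (hle : I ≤ LocConv.maxIdeal ℓ n) (hne : I ≠ LocConv.maxIdeal ℓ n) :
    ∃ c : Fin n → PadicAlgCl ℓ, (∃ i, c i ≠ 0) ∧
      Function.Surjective (LocConv.evalLine c) ∧
      I ≤ RingHom.ker (LocConv.evalLine c) ∧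
      ∃ k : ℕ, 0 < k ∧ ∃ a : (PadicAlgCl ℓ)ˣ, ∀ i, c i ≠ 0 → α i ^ k = a := by
  classical
  have hscale : ∀ f ∈ I, LocConv.scaleHom (fun i => (α i : PadicAlgCl ℓ)) f ∈ I := by
    intro f hf
    have h : LocConv.phi α f ∈ (I : Set (LocConv.locConv ℓ n)) := by
      rw [← hφ]
      exact ⟨f, hf, rfl⟩
    exact h
  obtain ⟨c₀, hc₀, h₀⟩ := LocConv.exists_common_zero
    (fun d e => LocConv.degree_eq_of_prod_pow_eq (Fact.out : p.Prime).one_lt hw hα)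
    hscale hI hle hne
  obtain ⟨c, hc, hcI, hfin⟩ := LocConv.exists_common_zero_isOfFinOrder_div α
    (Subtype.val '' (I : Set (LocConv.locConv ℓ n))) hc₀
    (by rintro _ ⟨f, hf, rfl⟩; exact h₀ f hf)
  obtain ⟨i, hi⟩ := Function.ne_iff.1 hc
  refine ⟨c, ⟨i, hi⟩, LocConv.evalLine_surjective hi,
    fun f hf => LocConv.evalLine_eq_zero (hcI _ ⟨f, hf, rfl⟩),
    -- The exponent is a common multiple of the orders of the ratios `α j / α i` over the support of
    -- `c`, with `i` fixed; it is positive because these orders are finite.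
    ∏ j with c j ≠ 0, orderOf (α j / α i), ?_,
    α i ^ ∏ j with c j ≠ 0, orderOf (α j / α i), fun j hj => ?_⟩
  · exact Finset.prod_pos fun j hj => (hfin j i (Finset.mem_filter.1 hj).2 hi).orderOf_pos
  · rw [← div_eq_one, ← div_pow, ← orderOf_dvd_iff_pow_eq_one]
    exact Finset.dvd_prod_of_mem (fun j => orderOf (α j / α i))
      (Finset.mem_filter.2 ⟨Finset.mem_univ j, hj⟩)
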